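/- Let $G=(V,E)$ be a finite simple connected graph, each of whose edges has been given a preferred direction $r\to s$, and let $H$ be a real symmetric matrix indexed by $V$ that is strictly supported on $G$: for $r\ne s$, $H_{rs}\neq 0$ if and only if $rs$ is an edge (the diagonal of $H$ is arbitrary). List the eigenvalues of a Hermitian matrix in ascending order with multiplicity, and suppose that the $k$-th eigenvalue $\lambda_k$ of $H$ is simple and that its real eigenvector $\psi$, normalized by $\sum_r\psi_r^2=1$, has no zero entries. Let $\Phi$ be the diagonal matrix on $\mathbb R^E$ with entries $\Phi_{(r\to s),(r\to s)}=-\psi_r H_{rs}\psi_s$. Let $d:\mathbb R^V\to\mathbb R^E$, $(d\theta)_{(r\to s)}=\theta_s-\theta_r$. Let $Z\subset\mathbb R^E$ be the cycle space, i.e. the space of $f\in\mathbb{R}^E$ such that at every vertex the sum of $f$ over the incoming edges equals the sum of $f$ over the outgoing edges, and let $H^1(G,\mathbb R)=\mathbb R^E/d\mathbb R^V$. Let $C$ be a frame of $Z$, i.e. an $|E|\times\beta$ matrix whose columns form a basis of $Z$. For $\alpha\in\mathbb R^E$ let $H_\alpha$ be the Hermitian matrix with entries $(H_\alpha)_{rs}=e^{i\alpha_{rs}}H_{rs}$,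 where $\alpha_{rs}=\alpha_{(r\to s)}$ if $(r\to s)\in E$, $\alpha_{rs}=-\alpha_{(s\to r)}$ if $(s\to r)\in E$, and $\alpha_{rs}=0$ otherwise. The function $\Lambda([\alpha])=\lambda_k(H_\alpha)$ is well defined on $H^1(G,\mathbb R)$, and $[\alpha]\mapsto\alpha\cdot C$ (row vector times matrix) is a linear isomorphism $H^1(G,\mathbb R)\to\mathbb R^\beta$, whose values are called the flux coordinates of $[\alpha]$. Then the weighted cycle intersection matrix $C^\top\Phi^{-1}C$ is invertible, $\Lambda$ written in flux coordinates is twice continuously differentiable at $0$, and the matrix of its second partial derivatives at $0$ is $$\operatorname{Hess}\Lambda = 2\left(C^\top\Phi^{-1}C\right)^{-1}.$$ -/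

import Mathlib

open Matrix

set_option linter.unusedSectionVars false

noncomputable section

namespace GraphMagnetic

variable {V : Type*} [Fintype V] [DecidableEq V]

/-- A choice of a preferred direction for every edge of the simple graph `G`:
`(r, s) ∈ edges` means that the edge `rs` is directed `r → s`, and every edge gets exactly one
of its two possible directions. -/
structure EdgeDirection (G : SimpleGraph V) where
  edges : Finset (V × V)
  adj_iff : ∀ r s, G.Adj r s ↔ (r, s) ∈ edges ∨ (s, r) ∈ edges
  asymm : ∀ r s, (r, s) ∈ edges → (s, r) ∉ edges

/-- `H` is strictly supported on `G`: for `r ≠ s`, `H r s ≠ 0` iff `rs` is an edge.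
The diagonal entries are arbitrary. -/
def IsStrictlySupported (G : SimpleGraph V) (H : Matrix V V ℝ) : Prop :=
  ∀ r s, r ≠ s → (H r s ≠ 0 ↔ G.Adj r s)

/-- The eigenvalues of a Hermitian matrix in ascending order and with multiplicity,
`λ₀ ≤ λ₁ ≤ …`, indexed from zero. -/
def ascEigenvalue {𝕜 : Type*} [RCLike 𝕜] {A : Matrix V V 𝕜} (hA : A.IsHermitian)
    (k : Fin (Fintype.card V)) : ℝ :=
  hA.eigenvalues₀ k.rev

variable {G : SimpleGraph V}

/-- The coboundary operator `d : ℝ^V → ℝ^E`, `(dθ)(r → s) = θ s - θ r`. -/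
def coboundary (o : EdgeDirection G) : (V → ℝ) →ₗ[ℝ] (o.edges → ℝ) where
  toFun θ e := θ e.1.2 - θ e.1.1
  map_add' θ η := by ext e; simp only [Pi.add_apply]; ring
  map_smul' c θ := by ext e; simp only [Pi.smul_apply, smul_eq_mul, RingHom.id_apply]; ring

/-- The boundary operator `d* : ℝ^E → ℝ^V`: the sum over the incoming edges minus the sum over
the outgoing edges. -/
def boundary (o : EdgeDirection G) : (o.edges → ℝ) →ₗ[ℝ] (V → ℝ) where
  toFun f r := (∑ e : o.edges with e.1.2 = r, f e) - ∑ e : o.edges with e.1.1 = r, f e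
  map_add' f g := by
    ext r; simp only [Pi.add_apply, Finset.sum_add_distrib]; ring
  map_smul' c f := by
    ext r
    simp only [Pi.smul_apply, smul_eq_mul, RingHom.id_apply, ← Finset.mul_sum]; ring

/-- The cycle space `Z = H₁(G, ℝ)`: the flows on `G`. -/
def cycleSpace (o : EdgeDirection G) : Submodule ℝ (o.edges → ℝ) :=
  LinearMap.ker (boundary o)

/-- A frame of the cycle space: a matrix whose columns form a basis of it. -/
structure IsFrame (o : EdgeDirection G) {β : ℕ} (C : Matrix o.edges (Fin β) ℝ) : Prop where
  linearIndependent : LinearIndependent ℝ C.col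
  span_eq : Submodule.span ℝ (Set.range C.col) = cycleSpace o

/-- The diagonal matrix `Φ` on `ℝ^E` with the entries `-ψ_r H_{rs} ψ_s`. -/
def edgeWeight (o : EdgeDirection G) (H : Matrix V V ℝ) (ψ : V → ℝ) :
    Matrix o.edges o.edges ℝ :=
  Matrix.diagonal fun e => -(ψ e.1.1 * H e.1.1 e.1.2 * ψ e.1.2)

/-- The first cohomology `H¹(G, ℝ) = C¹(G, ℝ) / dℝ^V`, with `C¹(G, ℝ) = ℝ^E`. -/
abbrev H1 (o : EdgeDirection G) : Type _ :=
  (o.edges → ℝ) ⧸ LinearMap.range (coboundary o)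

/-- A cochain as an antisymmetric form on pairs of vertices. -/
def antisymForm (o : EdgeDirection G) (α : o.edges → ℝ) (r s : V) : ℝ :=
  if h : (r, s) ∈ o.edges then α ⟨(r, s), h⟩
  else if h : (s, r) ∈ o.edges then -α ⟨(s, r), h⟩
  else 0

/-- The phase perturbation `H_α` of `H`, with the entries `exp(i α_{rs}) H_{rs}`. -/
def magnetic (o : EdgeDirection G) (H : Matrix V V ℝ) (α : o.edges → ℝ) : Matrix V V ℂ :=
  Matrix.of fun r s => Complex.exp (Complex.I * (antisymForm o α r s : ℂ)) * (H r s : ℂ)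

theorem antisymForm_swap (o : EdgeDirection G) (α : o.edges → ℝ) (r s : V) :
    antisymForm o α s r = -antisymForm o α r s := by
  unfold antisymForm
  by_cases h : (r, s) ∈ o.edges
  · simp [h, o.asymm r s h]
  · by_cases h' : (s, r) ∈ o.edges <;> simp [h, h']

theorem magnetic_isHermitian (o : EdgeDirection G) {H : Matrix V V ℝ} (hH : H.IsHermitian)
    (α : o.edges → ℝ) : (magnetic o H α).IsHermitian := by
  ext r s
  have h : H s r = H r s := by simpa using hH.apply r s
  simp [magnetic, ← Complex.exp_conj, antisymForm_swap o α r s, h]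

/-- The eigenvalue `Λ(α) = λ_k(H_α)` as a function on `C¹(G, ℝ)`. -/
def eigenvalueOnCochains (o : EdgeDirection G) {H : Matrix V V ℝ} (hH : H.IsHermitian)
    (k : Fin (Fintype.card V)) (α : o.edges → ℝ) : ℝ :=
  ascEigenvalue (magnetic_isHermitian o hH α) k

theorem ascEigenvalue_congr {𝕜 : Type*} [RCLike 𝕜] {A B : Matrix V V 𝕜} (hA : A.IsHermitian)
    (hB : B.IsHermitian) (h : A.charpoly = B.charpoly) (k : Fin (Fintype.card V)) :
    ascEigenvalue hA k = ascEigenvalue hB k := by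
  have : hA.eigenvalues₀ = hB.eigenvalues₀ := by
    simp_rw [← List.ofFn_inj, ← Matrix.IsHermitian.sort_roots_charpoly_eq_eigenvalues₀, h]
  unfold ascEigenvalue
  rw [this]

theorem antisymForm_add_coboundary (o : EdgeDirection G) (α : o.edges → ℝ) (θ : V → ℝ) (r s : V)
    (h : (r, s) ∈ o.edges ∨ (s, r) ∈ o.edges) :
    antisymForm o (α + coboundary o θ) r s = antisymForm o α r s + (θ s - θ r) := by
  unfold antisymForm
  by_cases h1 : (r, s) ∈ o.edges
  · simp [h1, coboundary]
  · have h2 : (s, r) ∈ o.edges := h.resolve_left h1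
    simp only [h1, h2, dif_pos, dif_neg, not_false_eq_true, Pi.add_apply]
    simp only [coboundary, LinearMap.coe_mk, AddHom.coe_mk]
    ring

/-- Gauge invariance: `H_{α + dθ}` and `H_α` have the same eigenvalues. -/
theorem eigenvalueOnCochains_add_coboundary (o : EdgeDirection G) {H : Matrix V V ℝ}
    (hH : H.IsHermitian) (hG : IsStrictlySupported G H) (k : Fin (Fintype.card V))
    (α : o.edges → ℝ) (θ : V → ℝ) :
    eigenvalueOnCochains o hH k (α + coboundary o θ) = eigenvalueOnCochains o hH k α := by
  apply ascEigenvalue_congr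
  let D : Matrix V V ℂ := Matrix.diagonal fun r => Complex.exp (-(Complex.I * θ r))
  let D' : Matrix V V ℂ := Matrix.diagonal fun r => Complex.exp (Complex.I * θ r)
  have hD : D' * D = 1 := by
    simp only [D, D', Matrix.diagonal_mul_diagonal, ← Complex.exp_add]
    simp
  have key : magnetic o H (α + coboundary o θ) = D * (magnetic o H α * D') := by
    ext r s
    simp only [D, D', Matrix.diagonal_mul, Matrix.mul_diagonal, magnetic, Matrix.of_apply]
    by_cases hz : H r s = 0
    · simp [hz]
    by_cases hrs : r = s
    · subst hrs
      have h0 : ∀ γ, antisymForm o γ r r = 0 := fun γ => by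
        have := antisymForm_swap o γ r r
        linarith
      rw [h0, h0]
      simp only [Complex.ofReal_zero, mul_zero, Complex.exp_zero, one_mul]
      rw [mul_comm (H r r : ℂ), ← mul_assoc, ← Complex.exp_add]
      simp
    · have hadj := (o.adj_iff r s).1 ((hG r s hrs).1 hz)
      rw [antisymForm_add_coboundary o α θ r s hadj]
      rw [mul_right_comm, ← mul_assoc, ← Complex.exp_add, ← Complex.exp_add]
      congr 2
      push_cast
      ring
  rw [key, Matrix.charpoly_mul_comm, Matrix.mul_assoc, hD, Matrix.mul_one]

/-- The eigenvalue `Λ([α]) = λ_k(H_α)` as a function on `H¹(G, ℝ)`. -/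
def eigenvalueOnH1 (o : EdgeDirection G) {H : Matrix V V ℝ} (hH : H.IsHermitian)
    (hG : IsStrictlySupported G H) (k : Fin (Fintype.card V)) : H1 o → ℝ :=
  Quotient.lift (eigenvalueOnCochains o hH k) (by
    intro a b hab
    obtain ⟨θ, hθ⟩ := (Submodule.quotientRel_def _).1 hab
    have : a = b + coboundary o θ := by rw [hθ]; abel
    rw [this, eigenvalueOnCochains_add_coboundary o hH hG])

theorem eigenvalueOnH1_mk (o : EdgeDirection G) {H : Matrix V V ℝ} (hH : H.IsHermitian)
    (hG : IsStrictlySupported G H) (k : Fin (Fintype.card V)) (α : o.edges → ℝ) :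
    eigenvalueOnH1 o hH hG k (Submodule.Quotient.mk α) =
      ascEigenvalue (magnetic_isHermitian o hH α) k := rfl

/-- `d*` is the transpose of `d`. -/
theorem coboundary_dotProduct (o : EdgeDirection G) (θ : V → ℝ) (f : o.edges → ℝ) :
    coboundary o θ ⬝ᵥ f = θ ⬝ᵥ boundary o f := by
  simp only [dotProduct, coboundary, boundary, LinearMap.coe_mk, AddHom.coe_mk, mul_sub, sub_mul,
    Finset.sum_sub_distrib, Finset.mul_sum, Finset.sum_filter]
  congr 1
  · rw [Finset.sum_comm]; simp
  · rw [Finset.sum_comm]; simp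

/-- A cochain that vanishes on every cycle is a coboundary, and conversely. -/
theorem mem_range_coboundary_iff (o : EdgeDirection G) (α : o.edges → ℝ) :
    α ∈ LinearMap.range (coboundary o) ↔ ∀ γ ∈ cycleSpace o, α ⬝ᵥ γ = 0 := by
  constructor
  · rintro ⟨θ, rfl⟩ γ hγ
    rw [coboundary_dotProduct, show boundary o γ = 0 from hγ, dotProduct_zero]
  · intro h
    have h1 : dotProductEquiv ℝ o.edges α ∈ LinearMap.range (boundary o).dualMap := by
      rw [LinearMap.range_dualMap_eq_dualAnnihilator_ker, Submodule.mem_dualAnnihilator]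
      exact h
    obtain ⟨g, hg⟩ := h1
    obtain ⟨θ, rfl⟩ := (dotProductEquiv ℝ V).surjective g
    refine ⟨θ, (dotProductEquiv ℝ o.edges).injective (LinearMap.ext fun γ => ?_)⟩
    refine (coboundary_dotProduct o θ γ).trans ?_
    exact LinearMap.congr_fun hg γ

theorem vecMul_frame_eq_zero_iff (o : EdgeDirection G) {β : ℕ} {C : Matrix o.edges (Fin β) ℝ}
    (hC : IsFrame o C) (α : o.edges → ℝ) :
    α ᵥ* C = 0 ↔ α ∈ LinearMap.range (coboundary o) := by
  rw [mem_range_coboundary_iff, ← hC.span_eq]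
  constructor
  · intro h γ hγ
    have hle : Submodule.span ℝ (Set.range C.col) ≤
        LinearMap.ker (dotProductEquiv ℝ o.edges α) := by
      rw [Submodule.span_le]
      rintro _ ⟨j, rfl⟩
      exact congrFun h j
    exact hle hγ
  · intro h
    ext j
    exact h _ (Submodule.subset_span ⟨j, rfl⟩)

/-- The flux coordinates `[α] ↦ α · C` on `H¹(G, ℝ)`. -/
def fluxCoordinates (o : EdgeDirection G) {β : ℕ} {C : Matrix o.edges (Fin β) ℝ}
    (hC : IsFrame o C) : H1 o ≃ₗ[ℝ] (Fin β → ℝ) :=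
  LinearEquiv.ofBijective
    ((LinearMap.range (coboundary o)).liftQ (Matrix.vecMulLinear C)
      (fun α hα => (vecMul_frame_eq_zero_iff o hC α).2 hα)) (by
    constructor
    · rw [← LinearMap.ker_eq_bot]
      refine Submodule.ker_liftQ_eq_bot _ _ _ fun α hα => ?_
      exact (vecMul_frame_eq_zero_iff o hC α).1 hα
    · obtain ⟨B, hB⟩ := (LinearMap.exists_leftInverse_of_injective C.mulVecLin
        (LinearMap.ker_eq_bot.2 (Matrix.mulVec_injective_iff.2 hC.linearIndependent)))
      have hBC : LinearMap.toMatrix' B * C = 1 := by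
        apply Matrix.toLin'.injective
        rw [Matrix.toLin'_mul, Matrix.toLin'_toMatrix', Matrix.toLin'_one]
        exact hB
      intro x
      refine ⟨Submodule.Quotient.mk (x ᵥ* LinearMap.toMatrix' B), ?_⟩
      change (x ᵥ* LinearMap.toMatrix' B) ᵥ* C = x
      rw [Matrix.vecMul_vecMul, hBC, Matrix.vecMul_one])

theorem fluxCoordinates_mk (o : EdgeDirection G) {β : ℕ} {C : Matrix o.edges (Fin β) ℝ}
    (hC : IsFrame o C) (α : o.edges → ℝ) :
    fluxCoordinates o hC (Submodule.Quotient.mk α) = α ᵥ* C := rfl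

/-- The Hessian matrix of `F` at `x`: the matrix of its second derivatives in the standard
basis. It is meaningful where `F` is twice differentiable. -/
def hessianMatrix {β : ℕ} (F : (Fin β → ℝ) → ℝ) (x : Fin β → ℝ) : Matrix (Fin β) (Fin β) ℝ :=
  Matrix.of fun i j => iteratedFDeriv ℝ 2 F x ![Pi.single i 1, Pi.single j 1]

end GraphMagnetic

end

/-! Gauge invariance allows each class in H¹ to be represented by the cochain α for which Φα is a
cycle (the harmonic gauge). For such α the first-order perturbation of H annihilates ψ: its
component at s, times ψ_s, is up to a factor ±i the boundary of Φα at s, and ψ_s ≠ 0. The response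
of the eigenvector therefore drops out at second order, and only the expectation in ψ of the second
variation of H_α is left: -∑_{r,s} ψ_r H_{rs} ψ_s α_{rs}² = 2 α·Φα
(`eigenvalueOnCochains_second_order`). With M = CᵀΦ⁻¹C, the harmonic representative of the flux x is
Φ⁻¹CM⁻¹x, and the form becomes 2 x·M⁻¹x.

M is invertible because d*Φd is H - λ_k multiplied on both sides by diag ψ
(`boundary_edgeWeight_mulVec_coboundary`); simplicity of λ_k then leaves only constants in its
kernel.

Smoothness comes from the implicit function theorem applied to the normalized eigenvector equation.
It yields some smooth eigenvalue branch; Weyl's inequality makes the ordered eigenvalues continuous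
and so identifies the branch with the k-th one (`eventually_eq_ascEigenvalue`). -/

noncomputable section

open Filter Topology

/-! ### Weyl's inequality for symmetric operators -/

namespace LinearMap.IsSymmetric

variable {𝕜 E : Type*} [RCLike 𝕜] [NormedAddCommGroup E] [InnerProductSpace 𝕜 E]
  [FiniteDimensional 𝕜 E] {S T : E →ₗ[𝕜] E} {n : ℕ}

theorem re_inner_apply_eq_sum (hT : T.IsSymmetric) (hn : Module.finrank 𝕜 E = n) (v : E) :
    RCLike.re (inner 𝕜 v (T v)) =
      ∑ i, hT.eigenvalues hn i * ‖inner 𝕜 (hT.eigenvectorBasis hn i) v‖ ^ 2 := by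
  rw [← (hT.eigenvectorBasis hn).sum_inner_mul_inner, map_sum]
  refine Finset.sum_congr rfl fun i _ => ?_
  rw [← hT, hT.apply_eigenvectorBasis, inner_smul_left, RCLike.conj_ofReal, mul_left_comm,
    RCLike.re_ofReal_mul, ← inner_conj_symm v, RCLike.conj_mul]
  norm_cast

/-- Courant–Fischer argument: some nonzero v lies both in the span of the top eigenvectors of S, up
to index k, and in the span of the bottom eigenvectors of T, from index k on. The two quadratic
forms are compared at v. -/
theorem eigenvalues_le_add (hS : S.IsSymmetric) (hT : T.IsSymmetric)
    (hn : Module.finrank 𝕜 E = n) {ε : ℝ}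
    (h : ∀ v, RCLike.re (inner 𝕜 v (S v)) ≤ RCLike.re (inner 𝕜 v (T v)) + ε * ‖v‖ ^ 2)
    (k : Fin n) : hS.eigenvalues hn k ≤ hT.eigenvalues hn k + ε := by
  let u := hS.eigenvectorBasis hn
  let w := hT.eigenvectorBasis hn
  -- The eigenvalues are in descending order. The n - 1 orthogonality conditions on v are padded
  -- with a zero k-th coordinate, so L cannot be surjective and, the dimensions being equal, has a
  -- kernel.
  let L : E →ₗ[𝕜] (Fin n → 𝕜) := LinearMap.pi fun i =>
    if i < k then (innerSL 𝕜 (w i)).toLinearMap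
    else if k < i then (innerSL 𝕜 (u i)).toLinearMap else 0
  have hL : ¬ Function.Injective L := by
    rw [LinearMap.injective_iff_surjective_of_finrank_eq_finrank (by simp [hn])]
    intro hs
    obtain ⟨v, hv⟩ := hs (Pi.single k 1)
    have := congrFun hv k
    simp [L] at this
  rw [← LinearMap.ker_eq_bot, Submodule.eq_bot_iff] at hL
  push Not at hL
  obtain ⟨v, hv, hv0⟩ := hL
  have hw : ∀ i, i < k → inner 𝕜 (w i) v = 0 := fun i hi => by
    have := congrFun (LinearMap.mem_ker.1 hv) i
    simpa [L, hi] using this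
  have hu : ∀ i, k < i → inner 𝕜 (u i) v = 0 := fun i hi => by
    have := congrFun (LinearMap.mem_ker.1 hv) i
    simpa [L, hi, hi.not_gt] using this
  have h1 : hS.eigenvalues hn k * ‖v‖ ^ 2 ≤ RCLike.re (inner 𝕜 v (S v)) := by
    rw [hS.re_inner_apply_eq_sum hn, ← u.sum_sq_norm_inner_right, Finset.mul_sum]
    refine Finset.sum_le_sum fun i _ => ?_
    rcases lt_or_ge k i with hi | hi
    · change _ * ‖inner 𝕜 (u i) v‖ ^ 2 ≤ _ * ‖inner 𝕜 (u i) v‖ ^ 2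
      simp [hu i hi]
    · exact mul_le_mul_of_nonneg_right (hS.eigenvalues_antitone hn hi) (sq_nonneg _)
  have h2 : RCLike.re (inner 𝕜 v (T v)) ≤ hT.eigenvalues hn k * ‖v‖ ^ 2 := by
    rw [hT.re_inner_apply_eq_sum hn, ← w.sum_sq_norm_inner_right, Finset.mul_sum]
    refine Finset.sum_le_sum fun i _ => ?_
    rcases lt_or_ge i k with hi | hi
    · change _ * ‖inner 𝕜 (w i) v‖ ^ 2 ≤ _ * ‖inner 𝕜 (w i) v‖ ^ 2
      simp [hw i hi]
    · exact mul_le_mul_of_nonneg_right (hT.eigenvalues_antitone hn hi) (sq_nonneg _)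
  have h3 : 0 < ‖v‖ ^ 2 := by positivity
  have h4 := h v
  exact le_of_mul_le_mul_right (by linarith) h3

end LinearMap.IsSymmetric

/-! ### Continuity and simplicity of ordered matrix eigenvalues -/

namespace GraphMagnetic

variable {V : Type*} [Fintype V] [DecidableEq V]

theorem ascEigenvalue_le_add {𝕜 : Type*} [RCLike 𝕜] {A B : Matrix V V 𝕜} (hA : A.IsHermitian)
    (hB : B.IsHermitian) (k : Fin (Fintype.card V)) :
    ascEigenvalue hA k ≤ ascEigenvalue hB k + ‖Matrix.toEuclideanCLM (𝕜 := 𝕜) (A - B)‖ := by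
  refine LinearMap.IsSymmetric.eigenvalues_le_add _ _ _ (fun v => ?_) _
  have h1 : RCLike.re (inner 𝕜 v (Matrix.toEuclideanCLM (𝕜 := 𝕜) (A - B) v)) ≤
      ‖Matrix.toEuclideanCLM (𝕜 := 𝕜) (A - B)‖ * ‖v‖ ^ 2 := by
    refine (RCLike.re_le_norm _).trans ((norm_inner_le_norm _ _).trans ?_)
    have := (Matrix.toEuclideanCLM (𝕜 := 𝕜) (A - B)).le_opNorm v
    nlinarith [norm_nonneg v]
  have h2 : RCLike.re (inner 𝕜 v (Matrix.toEuclideanCLM (𝕜 := 𝕜) (A - B) v)) =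
      RCLike.re (inner 𝕜 v (Matrix.toEuclideanLin A v)) -
        RCLike.re (inner 𝕜 v (Matrix.toEuclideanLin B v)) := by
    rw [map_sub, _root_.sub_apply, inner_sub_right, map_sub]
    rfl
  linarith

theorem abs_ascEigenvalue_sub_le {𝕜 : Type*} [RCLike 𝕜] {A B : Matrix V V 𝕜}
    (hA : A.IsHermitian) (hB : B.IsHermitian) (k : Fin (Fintype.card V)) :
    |ascEigenvalue hA k - ascEigenvalue hB k| ≤ ‖Matrix.toEuclideanCLM (𝕜 := 𝕜) (A - B)‖ := by
  have h1 := ascEigenvalue_le_add hA hB k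
  have h2 := ascEigenvalue_le_add hB hA k
  rw [← neg_sub A B, map_neg, norm_neg] at h2
  exact abs_sub_le_iff.2 ⟨by linarith, by linarith⟩

theorem tendsto_ascEigenvalue {𝕜 X : Type*} [RCLike 𝕜] {l : Filter X} {A : X → Matrix V V 𝕜}
    (hA : ∀ x, (A x).IsHermitian) {B : Matrix V V 𝕜} (hB : B.IsHermitian)
    (h : Tendsto A l (𝓝 B)) (k : Fin (Fintype.card V)) :
    Tendsto (fun x => ascEigenvalue (hA x) k) l (𝓝 (ascEigenvalue hB k)) := by
  have hc : Continuous fun M : Matrix V V 𝕜 => ‖Matrix.toEuclideanCLM (𝕜 := 𝕜) M‖ :=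
    continuous_norm.comp (LinearMap.continuous_of_finiteDimensional
      (Matrix.toEuclideanCLM (n := V) (𝕜 := 𝕜)).toAlgEquiv.toLinearMap)
  have h1 := (hc.tendsto 0).comp (tendsto_sub_nhds_zero_iff.2 h)
  simp only [map_zero, norm_zero] at h1
  rw [tendsto_iff_dist_tendsto_zero]
  exact squeeze_zero (fun _ => dist_nonneg) (fun x => abs_ascEigenvalue_sub_le (hA x) hB k) h1

theorem exists_ascEigenvalue_eq {𝕜 : Type*} [RCLike 𝕜] {A : Matrix V V 𝕜} (hA : A.IsHermitian)
    {v : V → 𝕜} (hv : v ≠ 0) {t : 𝕜} (h : A *ᵥ v = t • v) :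
    ∃ j, t = (ascEigenvalue hA j : 𝕜) := by
  have h1 : Module.End.HasEigenvalue (Matrix.toLin' A) t :=
    Module.End.hasEigenvalue_of_hasEigenvector
      (Module.End.hasEigenvector_iff.2 ⟨Module.End.mem_eigenspace_iff.2 h, hv⟩)
  have h2 := h1.mem_spectrum
  rw [Matrix.spectrum_toLin', hA.spectrum_eq_image_range] at h2
  obtain ⟨_, ⟨i, rfl⟩, rfl⟩ := h2
  exact ⟨((Fintype.equivOfCardEq (Fintype.card_fin _)).symm i).rev, by
    simp [ascEigenvalue, Matrix.IsHermitian.eigenvalues]⟩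

/-- Two equal entries of the list would put two orthonormal eigenvectors into a one-dimensional
space. -/
theorem ascEigenvalue_ne_of_finrank_eigenspace {A : Matrix V V ℝ} (hA : A.IsHermitian)
    {k : Fin (Fintype.card V)}
    (hk : Module.finrank ℝ (Module.End.eigenspace (Matrix.toLin' A) (ascEigenvalue hA k)) = 1)
    {j : Fin (Fintype.card V)} (hj : j ≠ k) : ascEigenvalue hA j ≠ ascEigenvalue hA k := by
  intro h
  let e := Fintype.equivOfCardEq (Fintype.card_fin (Fintype.card V)) (β := V)
  have hmem : ∀ i, ascEigenvalue hA i = ascEigenvalue hA k →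
      (hA.eigenvectorBasis (e i.rev)).ofLp ∈
        Module.End.eigenspace (Matrix.toLin' A) (ascEigenvalue hA k) := fun i hi => by
    rw [Module.End.mem_eigenspace_iff, Matrix.toLin'_apply, hA.mulVec_eigenvectorBasis, ← hi]
    simp [ascEigenvalue, Matrix.IsHermitian.eigenvalues, e]
  have hne : (⟨_, hmem k rfl⟩ : Module.End.eigenspace (Matrix.toLin' A) (ascEigenvalue hA k)) ≠ 0 :=
    fun h0 => hA.eigenvectorBasis.orthonormal.ne_zero (e k.rev)
      ((WithLp.ofLp_eq_zero 2).1 (congrArg Subtype.val h0))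
  obtain ⟨c, hc⟩ := (finrank_eq_one_iff_of_nonzero' _ hne).1 hk ⟨_, hmem j h⟩
  have hc' : c • hA.eigenvectorBasis (e k.rev) = hA.eigenvectorBasis (e j.rev) :=
    (WithLp.ofLp_injective 2) (congrArg Subtype.val hc)
  have h1 := hA.eigenvectorBasis.orthonormal.2
    (show e j.rev ≠ e k.rev from fun h => hj (Fin.rev_injective (e.injective h)))
  have h2 := hA.eigenvectorBasis.orthonormal.1 (e j.rev)
  dsimp only at h1
  rw [← hc', inner_smul_left] at h1
  have h3 := hA.eigenvectorBasis.orthonormal.1 (e k.rev)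
  rw [real_inner_self_eq_norm_sq, h3] at h1
  rw [← hc', norm_smul, h3] at h2
  simp at h1 h2
  simp [h1] at h2

/-- The sorted eigenvalues are the sorted roots of the characteristic polynomial, which already
splits over ℝ. This links the complex matrix H_0 with the real H. -/
theorem ascEigenvalue_map_ofReal {A : Matrix V V ℝ} (hA : A.IsHermitian)
    {B : Matrix V V ℂ} (hB : B.IsHermitian) (hAB : A.map Complex.ofReal = B)
    (k : Fin (Fintype.card V)) : ascEigenvalue hB k = ascEigenvalue hA k := by
  have hp : B.charpoly = A.charpoly.map Complex.ofRealHom := by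
    rw [← Matrix.charpoly_map, ← hAB]; rfl
  have : hB.eigenvalues₀ = hA.eigenvalues₀ := by
    rw [← List.ofFn_inj, ← Matrix.IsHermitian.sort_roots_charpoly_eq_eigenvalues₀,
      ← Matrix.IsHermitian.sort_roots_charpoly_eq_eigenvalues₀, hp,
      hA.splits_charpoly.roots_map]
    simp
  unfold ascEigenvalue
  rw [this]

end GraphMagnetic

/-! ### Smooth eigenpairs through the implicit function theorem -/

/-- A smooth family of matrices has a smooth eigenpair near a simple eigenvalue with a left
eigenvector `ψ` that is also a right eigenvector. -/
theorem Matrix.exists_contDiffAt_eigenpair {V E : Type*} [Fintype V] [DecidableEq V]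
    [NormedAddCommGroup E] [NormedSpace ℝ E] [CompleteSpace E]
    {A : E → Matrix V V ℂ} {x₀ : E} {n : WithTop ℕ∞} (hn : n ≠ 0)
    (hA : ∀ r s, ContDiffAt ℝ n (fun x => A x r s) x₀) {ψ : V → ℂ} {t₀ : ℂ}
    (hr : A x₀ *ᵥ ψ = t₀ • ψ) (hl : ψ ᵥ* A x₀ = t₀ • ψ) (hψ : ψ ⬝ᵥ ψ = 1)
    (hs : ∀ w, A x₀ *ᵥ w = t₀ • w → ∃ c : ℂ, w = c • ψ) :
    ∃ (v : E → V → ℂ) (t : E → ℂ), ContDiffAt ℝ n v x₀ ∧ ContDiffAt ℝ n t x₀ ∧ v x₀ = ψ ∧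
      t x₀ = t₀ ∧ ∀ᶠ x in 𝓝 x₀, A x *ᵥ v x = t x • v x ∧ ψ ⬝ᵥ v x = 1 := by
  -- The bilinear normalization ψ·v = 1 supplies the one equation needed to match the extra unknown
  -- t.
  let f : E × ((V → ℂ) × ℂ) → (V → ℂ) × ℂ := fun p =>
    (A p.1 *ᵥ p.2.1 - p.2.2 • p.2.1, ψ ⬝ᵥ p.2.1 - 1)
  let u : E × ((V → ℂ) × ℂ) := (x₀, (ψ, t₀))
  have hfu : f u = 0 := by simp [f, u, hr, hψ]
  have hf : ContDiffAt ℝ n f u := by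
    have hA' : ∀ r s, ContDiffAt ℝ n (fun p : E × ((V → ℂ) × ℂ) => A p.1 r s) u := fun r s =>
      ContDiffAt.comp u (hA r s) contDiffAt_fst
    have hv : ∀ s, ContDiffAt ℝ n (fun p : E × ((V → ℂ) × ℂ) => p.2.1 s) u := fun s => by
      fun_prop
    refine ContDiffAt.prodMk (contDiffAt_pi.2 fun r => ?_) ?_
    · simp only [Pi.sub_apply, Pi.smul_apply, Matrix.mulVec, dotProduct, smul_eq_mul]
      exact (ContDiffAt.sum fun s _ => (hA' r s).mul (hv s)).sub
        (ContDiffAt.mul (by fun_prop) (hv r))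
    · simp only [dotProduct]
      exact (ContDiffAt.sum fun s _ => contDiffAt_const.mul (hv s)).sub contDiffAt_const
  have hD : HasFDerivAt (fun p => f (x₀, p)) (fderiv ℝ f u ∘L .inr ℝ E _) u.2 :=
    (hf.differentiableAt hn).hasFDerivAt.comp u.2 (hasFDerivAt_prodMk_right x₀ u.2)
  let M : (V → ℂ) →L[ℝ] (V → ℂ) :=
    ((Matrix.mulVecLin (A x₀)).restrictScalars ℝ).toContinuousLinearMap
  let d : (V → ℂ) →L[ℝ] ℂ :=
    ((dotProductBilin ℂ ℂ ψ).restrictScalars ℝ).toContinuousLinearMap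
  have hD' := ((M.hasFDerivAt.comp u.2 (hasFDerivAt_fst (𝕜 := ℝ))).sub
    (hasFDerivAt_snd.smul hasFDerivAt_fst)).prodMk
      ((d.hasFDerivAt.comp u.2 (hasFDerivAt_fst (𝕜 := ℝ))).sub_const 1)
  have heq := hD.unique hD'
  -- Pairing (A - t₀)w = τψ with the left eigenvector ψ gives τ = 0. Then w = cψ, and ψ·w = 0 forces
  -- c = 0. In finite dimension injectivity suffices.
  have hinj : Function.Injective (fderiv ℝ f u ∘L .inr ℝ E ((V → ℂ) × ℂ)) := by
    rw [injective_iff_map_eq_zero]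
    rintro ⟨w, τ⟩ hw
    rw [heq] at hw
    have h1 : A x₀ *ᵥ w - (t₀ • w + τ • ψ) = 0 := congrArg Prod.fst hw
    have h2 : ψ ⬝ᵥ w = 0 := congrArg Prod.snd hw
    have h3 := congrArg (ψ ⬝ᵥ ·) h1
    simp only [dotProduct_sub, dotProduct_add, dotProduct_mulVec, hl, smul_dotProduct,
      dotProduct_smul, h2, hψ, dotProduct_zero] at h3
    have hτ : τ = 0 := by simpa using h3
    subst hτ
    obtain ⟨c, rfl⟩ := hs w (by simpa [sub_eq_zero] using h1)
    have hc : c = 0 := by simpa [hψ] using h2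
    simp [hc]
  have hinv : (fderiv ℝ f u ∘L .inr ℝ E ((V → ℂ) × ℂ)).IsInvertible :=
    ⟨(LinearEquiv.ofInjectiveEndo (fderiv ℝ f u ∘L .inr ℝ E ((V → ℂ) × ℂ)).toLinearMap
      hinj).toContinuousLinearEquiv, by ext <;> rfl⟩
  have hg := hf.contDiffAt_implicitFunction hn hinv
  have hg0 : hf.implicitFunction hn hinv x₀ = (ψ, t₀) :=
    hf.implicitFunction_apply_self hn hinv
  refine ⟨fun x => (hf.implicitFunction hn hinv x).1, fun x => (hf.implicitFunction hn hinv x).2,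
    hg.fst, hg.snd,
    congrArg Prod.fst hg0, congrArg Prod.snd hg0, ?_⟩
  filter_upwards [hf.eventually_apply_implicitFunction hn hinv] with x hx
  rw [hfu] at hx
  exact ⟨sub_eq_zero.1 (congrArg Prod.fst hx), sub_eq_zero.1 (congrArg Prod.snd hx)⟩

namespace GraphMagnetic

variable {V : Type*} [Fintype V] [DecidableEq V]

/-- Near a point where the `k`-th eigenvalue is simple, an eigenvalue that depends continuously on
the parameter stays the `k`-th one. -/
theorem eventually_eq_ascEigenvalue {X : Type*} {l : Filter X}
    {A : X → Matrix V V ℂ} (hA : ∀ x, (A x).IsHermitian) {B : Matrix V V ℂ} (hB : B.IsHermitian)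
    (hAB : Tendsto A l (𝓝 B)) {k : Fin (Fintype.card V)}
    (hk : ∀ j, j ≠ k → ascEigenvalue hB j ≠ ascEigenvalue hB k)
    {v : X → V → ℂ} {t : X → ℂ} (ht : Tendsto t l (𝓝 (ascEigenvalue hB k : ℂ)))
    (hv : ∀ᶠ x in l, v x ≠ 0) (h : ∀ᶠ x in l, A x *ᵥ v x = t x • v x) :
    ∀ᶠ x in l, t x = (ascEigenvalue (hA x) k : ℂ) := by
  -- The other ordered eigenvalues converge to limits different from the limit of t, so they
  -- eventually avoid t x.
  have hne : ∀ᶠ x in l, ∀ j, j ≠ k → (ascEigenvalue (hA x) j : ℂ) ≠ t x := by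
    refine eventually_all.2 fun j => ?_
    by_cases hj : j = k
    · exact Eventually.of_forall fun x h => absurd hj h
    · have h1 := (Complex.continuous_ofReal.tendsto _).comp (tendsto_ascEigenvalue hA hB hAB j)
      have h2 : (ascEigenvalue hB j : ℂ) - ascEigenvalue hB k ≠ 0 :=
        sub_ne_zero.2 (Complex.ofReal_injective.ne (hk j hj))
      filter_upwards [(h1.sub ht).eventually_ne h2] with x hx _ using sub_ne_zero.1 hx
  filter_upwards [hne, hv, h] with x h1 h2 h3
  obtain ⟨j, hj⟩ := exists_ascEigenvalue_eq (hA x) h2 h3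
  by_cases hjk : j = k
  · rw [← hjk]; exact hj
  · exact absurd hj.symm (h1 j hjk)

end GraphMagnetic

/-! ### Sums over vertex pairs, the weighted Laplacian and the cycle intersection matrix -/

namespace GraphMagnetic

variable {V : Type*} [Fintype V] [DecidableEq V] {G : SimpleGraph V}

theorem antisymForm_eq_sum (o : EdgeDirection G) (α : o.edges → ℝ) (r s : V) :
    antisymForm o α r s =
      (∑ e : o.edges, if e.1 = (r, s) then α e else 0) -
        ∑ e : o.edges, if e.1 = (s, r) then α e else 0 := by
  have key : ∀ p : V × V, (∑ e : o.edges, if e.1 = p then α e else 0) =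
      if h : p ∈ o.edges then α ⟨p, h⟩ else 0 := fun p => by
    split_ifs with h
    · rw [Finset.sum_eq_single ⟨p, h⟩ (fun e _ he => if_neg fun h' => he (Subtype.ext h')) (by simp)]
      simp
    · exact Finset.sum_eq_zero fun e _ => if_neg fun h' => h (by rw [← h']; exact e.2)
  rw [key, key]
  unfold antisymForm
  by_cases h : (r, s) ∈ o.edges
  · simp [h, o.asymm r s h]
  · by_cases h' : (s, r) ∈ o.edges <;> simp [h, h']

/-- Each edge is met by two ordered pairs, which carry opposite signs. -/
theorem sum_mul_antisymForm (o : EdgeDirection G) (g : V → V → ℝ) (α : o.edges → ℝ) :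
    ∑ r, ∑ s, g r s * antisymForm o α r s =
      ∑ e : o.edges, (g e.1.1 e.1.2 - g e.1.2 e.1.1) * α e := by
  have key : ∀ e : o.edges, ∑ p : V × V, (if e.1 = p then g p.1 p.2 * α e else 0) =
      g e.1.1 e.1.2 * α e := fun e => by simp
  have key' : ∀ e : o.edges, ∑ p : V × V, (if e.1 = (p.2, p.1) then g p.1 p.2 * α e else 0) =
      g e.1.2 e.1.1 * α e := fun e => by
    rw [← (Equiv.prodComm V V).sum_comp]
    simp
  rw [← Fintype.sum_prod_type' (fun r s => g r s * antisymForm o α r s)]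
  simp only [antisymForm_eq_sum, mul_sub, Finset.mul_sum, mul_ite, mul_zero, sub_mul,
    Finset.sum_sub_distrib]
  congr 1
  · rw [Finset.sum_comm]
    exact Finset.sum_congr rfl fun e _ => key e
  · rw [Finset.sum_comm]
    exact Finset.sum_congr rfl fun e _ => key' e

theorem sum_mul_antisymForm_eq_boundary (o : EdgeDirection G) {w : V → V → ℝ}
    (hw : ∀ r s, w r s = w s r) (α : o.edges → ℝ) (s : V) :
    ∑ r, w r s * antisymForm o α r s = boundary o (fun e => w e.1.1 e.1.2 * α e) s := by
  -- The indicator of s' = s restricts the double sum to the pairs that end at s.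
  have h := sum_mul_antisymForm o (fun r s' => if s' = s then w r s' else 0) α
  simp only [ite_mul, zero_mul, Finset.sum_ite_eq', Finset.mem_univ, if_true] at h
  rw [h]
  simp only [boundary, LinearMap.coe_mk, AddHom.coe_mk, Finset.sum_filter,
    ← Finset.sum_sub_distrib]
  refine Finset.sum_congr rfl fun e _ => ?_
  rw [hw e.1.2 e.1.1, sub_mul, ite_mul, ite_mul, zero_mul]

theorem sum_mul_antisymForm_mul_antisymForm (o : EdgeDirection G) {w : V → V → ℝ}
    (hw : ∀ r s, w r s = w s r) (α γ : o.edges → ℝ) :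
    ∑ r, ∑ s, w r s * antisymForm o α r s * antisymForm o γ r s =
      2 * ∑ e : o.edges, w e.1.1 e.1.2 * α e * γ e := by
  rw [sum_mul_antisymForm o (fun r s => w r s * antisymForm o α r s) γ, Finset.mul_sum]
  refine Finset.sum_congr rfl fun e _ => ?_
  have h : antisymForm o α e.1.1 e.1.2 = α e := by
    unfold antisymForm
    exact dif_pos e.2
  rw [antisymForm_swap o α e.1.1 e.1.2, h, hw e.1.2 e.1.1]
  ring

/-- `antisymForm o α r s` as a linear functional of `α`. -/
def antisymFormLM (o : EdgeDirection G) (r s : V) : (o.edges → ℝ) →ₗ[ℝ] ℝ where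
  toFun α := antisymForm o α r s
  map_add' α γ := by
    simp only [antisymForm_eq_sum, Pi.add_apply, ← Finset.sum_sub_distrib, ← Finset.sum_add_distrib]
    refine Finset.sum_congr rfl fun e _ => ?_
    split_ifs <;> ring
  map_smul' c α := by
    simp only [antisymForm_eq_sum, Pi.smul_apply, ← Finset.sum_sub_distrib,
      RingHom.id_apply, smul_eq_mul, Finset.mul_sum]
    refine Finset.sum_congr rfl fun e _ => ?_
    split_ifs <;> ring

variable {H : Matrix V V ℝ} {ψ : V → ℝ}

theorem symm_mul_apply_mul (hH : H.IsHermitian) (ψ : V → ℝ) (r s : V) :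
    ψ r * H r s * ψ s = ψ s * H s r * ψ r := by
  have h : H s r = H r s := by simpa using hH.apply r s
  rw [h]; ring

theorem edgeWeight_mul_inv (o : EdgeDirection G) (hG : IsStrictlySupported G H)
    (hne : ∀ r, ψ r ≠ 0) : edgeWeight o H ψ * (edgeWeight o H ψ)⁻¹ = 1 := by
  refine Matrix.mul_nonsing_inv _ ?_
  rw [edgeWeight, Matrix.det_diagonal, isUnit_iff_ne_zero, Finset.prod_ne_zero_iff]
  intro e _
  have hadj := (o.adj_iff e.1.1 e.1.2).2 (Or.inl e.2)
  exact neg_ne_zero.2 (mul_ne_zero (mul_ne_zero (hne _) ((hG _ _ hadj.ne).2 hadj)) (hne _))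

theorem boundary_edgeWeight_mulVec (o : EdgeDirection G) (hH : H.IsHermitian)
    (α : o.edges → ℝ) (s : V) :
    boundary o (edgeWeight o H ψ *ᵥ α) s =
      -∑ r, ψ r * H r s * ψ s * antisymForm o α r s := by
  rw [sum_mul_antisymForm_eq_boundary o (symm_mul_apply_mul hH ψ), ← Pi.neg_apply, ← map_neg]
  refine congrFun (congrArg (boundary o) (funext fun e => ?_)) s
  simp [edgeWeight, Matrix.mulVec_diagonal]

/-- Ground-state substitution: the eigenvalue equation for ψ turns the diagonal part of the weighted
Laplacian d*Φd into the λ-term, so that d*Φd = diag ψ (H - λ) diag ψ. -/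
theorem boundary_edgeWeight_mulVec_coboundary (o : EdgeDirection G) (hH : H.IsHermitian)
    (hG : IsStrictlySupported G H) {t : ℝ} (hψ : H *ᵥ ψ = t • ψ) (θ : V → ℝ) (s : V) :
    boundary o (edgeWeight o H ψ *ᵥ coboundary o θ) s =
      ψ s * ((H *ᵥ (ψ * θ)) s - t * (ψ s * θ s)) := by
  have hterm : ∀ r, ψ r * H r s * ψ s * antisymForm o (coboundary o θ) r s =
      ψ r * H r s * ψ s * (θ s - θ r) := fun r => by
    by_cases hz : H r s = 0
    · simp [hz]
    by_cases hrs : r = s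
    · subst hrs
      have := antisymForm_swap o (coboundary o θ) r r
      rw [show antisymForm o (coboundary o θ) r r = 0 by linarith, sub_self]
    · have h0 : antisymForm o 0 r s = 0 := (antisymFormLM o r s).map_zero
      have h := antisymForm_add_coboundary o 0 θ r s ((o.adj_iff r s).1 ((hG r s hrs).1 hz))
      rw [zero_add, h0, zero_add] at h
      rw [h]
  rw [boundary_edgeWeight_mulVec o hH]
  simp only [hterm]
  have hs := congrFun hψ s
  simp only [Matrix.mulVec, dotProduct, Pi.smul_apply, smul_eq_mul, Pi.mul_apply] at hs ⊢
  rw [mul_sub, show ψ s * (t * (ψ s * θ s)) = (t * ψ s) * (ψ s * θ s) by ring, ← hs,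
    Finset.mul_sum, Finset.sum_mul, ← Finset.sum_sub_distrib, ← Finset.sum_neg_distrib]
  refine Finset.sum_congr rfl fun r _ => ?_
  have h : H s r = H r s := by simpa using hH.apply r s
  rw [h]; ring

theorem boundary_frame_mulVec (o : EdgeDirection G) {β : ℕ} {C : Matrix o.edges (Fin β) ℝ}
    (hC : IsFrame o C) (y : Fin β → ℝ) : boundary o (C *ᵥ y) = 0 := by
  have : C *ᵥ y ∈ cycleSpace o := by
    rw [← hC.span_eq, ← Matrix.range_mulVecLin]
    exact ⟨y, rfl⟩
  exact this

/-- If y is in the kernel, Φ⁻¹Cy has zero flux, so it equals some dθ, and Φdθ = Cy has zero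
boundary. Hence ψθ is an eigenvector for the same eigenvalue, θ is constant, Cy = 0 and y = 0. -/
theorem isUnit_cycleIntersection (o : EdgeDirection G) (hH : H.IsHermitian)
    (hG : IsStrictlySupported G H) {t : ℝ} (hψ : H *ᵥ ψ = t • ψ) (hne : ∀ r, ψ r ≠ 0)
    (hs : ∀ w : V → ℝ, H *ᵥ w = t • w → ∃ c : ℝ, w = c • ψ)
    {β : ℕ} {C : Matrix o.edges (Fin β) ℝ} (hC : IsFrame o C) :
    IsUnit (Cᵀ * (edgeWeight o H ψ)⁻¹ * C) := by
  rw [← Matrix.mulVec_injective_iff_isUnit]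
  change Function.Injective (Matrix.mulVecLin _)
  rw [injective_iff_map_eq_zero]
  intro y hy
  have h1 : ((edgeWeight o H ψ)⁻¹ *ᵥ (C *ᵥ y)) ᵥ* C = 0 := by
    rw [← Matrix.mulVec_transpose, Matrix.mulVec_mulVec, Matrix.mulVec_mulVec]
    exact hy
  obtain ⟨θ, hθ⟩ := (vecMul_frame_eq_zero_iff o hC _).1 h1
  have h2 : edgeWeight o H ψ *ᵥ coboundary o θ = C *ᵥ y := by
    rw [hθ, Matrix.mulVec_mulVec, edgeWeight_mul_inv o hG hne, Matrix.one_mulVec]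
  have h3 : H *ᵥ (ψ * θ) = t • (ψ * θ) := by
    ext s
    have h := boundary_edgeWeight_mulVec_coboundary o hH hG hψ θ s
    rw [h2, boundary_frame_mulVec o hC, Pi.zero_apply, eq_comm, mul_eq_zero] at h
    simpa [sub_eq_zero] using h.resolve_left (hne s)
  obtain ⟨c, hc⟩ := hs _ h3
  have h4 : ∀ r, θ r = c := fun r => mul_left_cancel₀ (hne r)
    ((congrFun hc r).trans (mul_comm c (ψ r)))
  have h5 : coboundary o θ = 0 := by
    ext e
    simp [coboundary, h4]
  rw [h5, Matrix.mulVec_zero] at h2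
  exact Matrix.mulVec_injective_iff.2 hC.linearIndependent (h2.symm.trans (Matrix.mulVec_zero C).symm)

end GraphMagnetic

/-! ### Calculus of second derivatives -/

/-- `f` is differentiable near `x` and `B` is the derivative of its derivative at `x`. -/
def HasSecondFDerivAt {E F : Type*} [NormedAddCommGroup E] [NormedSpace ℝ E]
    [NormedAddCommGroup F] [NormedSpace ℝ F] (f : E → F) (B : E →L[ℝ] E →L[ℝ] F) (x : E) : Prop :=
  ∃ f' : E → E →L[ℝ] F, (∀ᶠ y in 𝓝 x, HasFDerivAt f (f' y) y) ∧ HasFDerivAt f' B x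

namespace HasSecondFDerivAt

variable {E F F' : Type*} [NormedAddCommGroup E] [NormedSpace ℝ E]
  [NormedAddCommGroup F] [NormedSpace ℝ F] [NormedAddCommGroup F'] [NormedSpace ℝ F']
  {f g : E → F} {B B' : E →L[ℝ] E →L[ℝ] F} {x : E}

theorem iteratedFDeriv_eq (h : HasSecondFDerivAt f B x) (m : Fin 2 → E) :
    iteratedFDeriv ℝ 2 f x m = B (m 0) (m 1) := by
  obtain ⟨f', h1, h2⟩ := h
  have h3 : fderiv ℝ f =ᶠ[𝓝 x] f' := h1.mono fun y hy => hy.fderiv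
  rw [iteratedFDeriv_two_apply, h3.fderiv_eq, h2.fderiv]

theorem congr_of_eventuallyEq (h : HasSecondFDerivAt f B x) (hg : g =ᶠ[𝓝 x] f) :
    HasSecondFDerivAt g B x := by
  obtain ⟨f', h1, h2⟩ := h
  refine ⟨f', ?_, h2⟩
  filter_upwards [h1, hg.eventuallyEq_nhds] with y h3 h4
  exact h3.congr_of_eventuallyEq h4

theorem add (hf : HasSecondFDerivAt f B x) (hg : HasSecondFDerivAt g B' x) :
    HasSecondFDerivAt (fun y => f y + g y) (B + B') x := by
  obtain ⟨f', h1, h2⟩ := hf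
  obtain ⟨g', h3, h4⟩ := hg
  refine ⟨fun y => f' y + g' y, ?_, h2.add h4⟩
  filter_upwards [h1, h3] with y h5 h6 using h5.add h6

theorem const (c : F) : HasSecondFDerivAt (fun _ : E => c) 0 x :=
  ⟨fun _ => 0, Eventually.of_forall fun y => hasFDerivAt_const c y, hasFDerivAt_const _ _⟩

theorem sum {ι : Type*} {s : Finset ι} {f : ι → E → F} {B : ι → E →L[ℝ] E →L[ℝ] F}
    (h : ∀ i ∈ s, HasSecondFDerivAt (f i) (B i) x) :
    HasSecondFDerivAt (fun y => ∑ i ∈ s, f i y) (∑ i ∈ s, B i) x := by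
  classical
  induction s using Finset.induction_on with
  | empty => simpa using const 0
  | insert i s hi ih =>
    simp only [Finset.sum_insert hi]
    exact (h i (s.mem_insert_self i)).add (ih fun j hj => h j (Finset.mem_insert_of_mem hj))

theorem clm_comp (L : F →L[ℝ] F') (hf : HasSecondFDerivAt f B x) :
    HasSecondFDerivAt (fun y => L (f y)) (ContinuousLinearMap.compL ℝ E F F' L ∘L B) x := by
  obtain ⟨f', h1, h2⟩ := hf
  refine ⟨fun y => L ∘L f' y, ?_, (ContinuousLinearMap.compL ℝ E F F' L).hasFDerivAt.comp x h2⟩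
  filter_upwards [h1] with y h3 using L.hasFDerivAt.comp y h3

/-- Every term of the Leibniz expansion of the second derivative contains P(x), P'(x) or q(x). This
disposes of the eigenvector response. -/
theorem mul_of_eq_zero {P q : E → ℂ} (hP : ContDiffAt ℝ 2 P x) (hq : ContDiffAt ℝ 2 q x)
    (hP0 : P x = 0) (hP1 : HasFDerivAt P (0 : E →L[ℝ] ℂ) x) (hq0 : q x = 0) :
    HasSecondFDerivAt (fun y => P y * q y) 0 x := by
  have hd : ∀ {g : E → ℂ}, ContDiffAt ℝ 2 g x → ∀ᶠ y in 𝓝 x, HasFDerivAt g (fderiv ℝ g y) y :=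
    fun hg => (hg.eventually (by simp)).mono fun y hy =>
      (hy.differentiableAt (by simp)).hasFDerivAt
  have hdd : ∀ {g : E → ℂ}, ContDiffAt ℝ 2 g x →
      HasFDerivAt (fderiv ℝ g) (fderiv ℝ (fderiv ℝ g) x) x := fun hg =>
    ((hg.fderiv_right (m := 1) (by norm_num)).differentiableAt (by simp)).hasFDerivAt
  refine ⟨fun y => P y • fderiv ℝ q y + q y • fderiv ℝ P y, ?_, ?_⟩
  · filter_upwards [hd hP, hd hq] with y h1 h2 using h1.mul h2
  · have h := (hP1.smul (hdd hq)).add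
      (((hq.differentiableAt (by simp)).hasFDerivAt).smul (hdd hP))
    rw [hP0, hq0, hP1.fderiv] at h
    refine h.congr_fderiv ?_
    ext u w
    simp

end HasSecondFDerivAt

theorem ContinuousLinearMap.hasFDerivAt_exp_I_mul {E : Type*} [NormedAddCommGroup E]
    [NormedSpace ℝ E] (l : E →L[ℝ] ℝ) (x : E) :
    HasFDerivAt (fun y => Complex.exp (Complex.I * (l y : ℂ)))
      (Complex.exp (Complex.I * (l x : ℂ)) • (Complex.I • (Complex.ofRealCLM ∘L l))) x :=
  (((Complex.ofRealCLM ∘L l).hasFDerivAt (x := x)).const_mul Complex.I).cexp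

theorem ContinuousLinearMap.hasSecondFDerivAt_exp_I_mul {E : Type*} [NormedAddCommGroup E]
    [NormedSpace ℝ E] (l : E →L[ℝ] ℝ) (c : ℂ) :
    ∃ B, HasSecondFDerivAt (fun y => c * (Complex.exp (Complex.I * (l y : ℂ)) - 1)) B 0 ∧
      ∀ u w, B u w = -(c * (l u * l w)) := by
  refine ⟨_, ⟨fun x => c • (Complex.exp (Complex.I * (l x : ℂ)) •
    (Complex.I • (Complex.ofRealCLM ∘L l))), Eventually.of_forall fun x =>
      ((l.hasFDerivAt_exp_I_mul x).sub_const 1).const_mul c,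
      ((l.hasFDerivAt_exp_I_mul 0).smul_const
        (Complex.I • (Complex.ofRealCLM ∘L l))).const_smul c⟩, fun u w => ?_⟩
  simp
  linear_combination c * l u * l w * Complex.I_mul_I

/-- A real eigenvalue with a one-dimensional real eigenspace has a one-dimensional complex
eigenspace. -/
theorem Matrix.exists_eq_smul_of_map_ofReal_mulVec {V : Type*} [Fintype V] {H : Matrix V V ℝ}
    {t : ℝ} {ψ : V → ℝ} (hs : ∀ w : V → ℝ, H *ᵥ w = t • w → ∃ c : ℝ, w = c • ψ) {w : V → ℂ}
    (hw : H.map Complex.ofReal *ᵥ w = (t : ℂ) • w) :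
    ∃ c : ℂ, w = c • fun r => (ψ r : ℂ) := by
  obtain ⟨a, ha⟩ := hs (fun r => (w r).re) (by
    ext r
    simpa [Matrix.mulVec, dotProduct] using congrArg Complex.re (congrFun hw r))
  obtain ⟨b, hb⟩ := hs (fun r => (w r).im) (by
    ext r
    simpa [Matrix.mulVec, dotProduct] using congrArg Complex.im (congrFun hw r))
  refine ⟨a + b * Complex.I, funext fun r => ?_⟩
  have h1 := congrFun ha r
  have h2 := congrFun hb r
  apply Complex.ext <;> simp_all

/-! ### Second-order perturbation in the harmonic gauge -/

namespace GraphMagnetic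

variable {V : Type*} [Fintype V] [DecidableEq V] {G : SimpleGraph V}
  {H : Matrix V V ℝ} {ψ : V → ℝ}

theorem magnetic_zero (o : EdgeDirection G) (H : Matrix V V ℝ) :
    magnetic o H 0 = H.map Complex.ofReal := by
  ext r s
  have h : antisymForm o 0 r s = 0 := (antisymFormLM o r s).map_zero
  simp [magnetic, h]

/-- In a gauge that is harmonic for the weights `edgeWeight o H ψ`, the `k`-th eigenvalue is
smooth at zero and its second derivative is the quadratic form of `2 • edgeWeight o H ψ`. -/
theorem eigenvalueOnCochains_second_order {E : Type*} [NormedAddCommGroup E] [NormedSpace ℝ E]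
    [FiniteDimensional ℝ E] (o : EdgeDirection G) (hH : H.IsHermitian)
    (k : Fin (Fintype.card V))
    (hk : ∀ j, j ≠ k → ascEigenvalue hH j ≠ ascEigenvalue hH k)
    (hψ : H *ᵥ ψ = ascEigenvalue hH k • ψ) (hnorm : ∑ r, ψ r ^ 2 = 1) (hne : ∀ r, ψ r ≠ 0)
    (hs : ∀ w : V → ℝ, H *ᵥ w = ascEigenvalue hH k • w → ∃ c : ℝ, w = c • ψ)
    (L : E →ₗ[ℝ] (o.edges → ℝ)) (hL : ∀ x, boundary o (edgeWeight o H ψ *ᵥ L x) = 0) :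
    ContDiffAt ℝ 2 (fun x => eigenvalueOnCochains o hH k (L x)) 0 ∧
      ∀ u w, iteratedFDeriv ℝ 2 (fun x => eigenvalueOnCochains o hH k (L x)) 0 ![u, w] =
        2 * (L u ⬝ᵥ edgeWeight o H ψ *ᵥ L w) := by
  have : CompleteSpace E := FiniteDimensional.complete ℝ E
  let l : V → V → E →L[ℝ] ℝ := fun r s => (antisymFormLM o r s ∘ₗ L).toContinuousLinearMap
  let A : E → Matrix V V ℂ := fun x => magnetic o H (L x)
  let ψc : V → ℂ := fun r => (ψ r : ℂ)
  set t₀ := ascEigenvalue hH k with ht₀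
  have hA : ∀ x, (A x).IsHermitian := fun x => magnetic_isHermitian o hH (L x)
  have hAapp : ∀ x r s, A x r s = Complex.exp (Complex.I * (l r s x : ℂ)) * (H r s : ℂ) :=
    fun x r s => rfl
  have hA0 : A 0 = H.map Complex.ofReal := by
    rw [← magnetic_zero o H]
    simp [A]
  have hAc : ∀ r s, ContDiff ℝ 2 (fun x => A x r s) := fun r s => by
    simp only [hAapp]
    exact (((contDiff_const.mul (Complex.ofRealCLM.contDiff.comp (l r s).contDiff)).cexp).mul
      contDiff_const)
  have hHsymm : Hᵀ = H := by simpa [Matrix.IsHermitian] using hH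
  have hr : A 0 *ᵥ ψc = (t₀ : ℂ) • ψc := by
    ext r
    have h := congrArg (Complex.ofReal) (congrFun hψ r)
    simpa [hA0, ψc, Matrix.mulVec, dotProduct] using h
  have hl : ψc ᵥ* A 0 = (t₀ : ℂ) • ψc := by
    rw [← Matrix.mulVec_transpose, hA0, ← Matrix.transpose_map, hHsymm, ← hA0, hr]
  have hψ1 : ψc ⬝ᵥ ψc = 1 := by
    have h := congrArg (Complex.ofReal) hnorm
    simpa [ψc, dotProduct, sq] using h
  obtain ⟨v, t, hv, ht, hv0, htz, hev⟩ := Matrix.exists_contDiffAt_eigenpair (n := 2) (by simp)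
    (fun r s => (hAc r s).contDiffAt) hr hl hψ1
    (fun w hw => Matrix.exists_eq_smul_of_map_ofReal_mulVec hs (hA0 ▸ hw))
  have heig : ∀ j, ascEigenvalue (hA 0) j = ascEigenvalue hH j :=
    ascEigenvalue_map_ofReal hH (hA 0) hA0.symm
  have hAcont : Tendsto A (𝓝 0) (𝓝 (A 0)) :=
    Continuous.tendsto (continuous_matrix fun r s => (hAc r s).continuous) 0
  have hkt : ∀ᶠ x in 𝓝 0, t x = (ascEigenvalue (hA x) k : ℂ) := by
    refine eventually_eq_ascEigenvalue hA (hA 0) hAcont (fun j hj => ?_) (v := v) ?_ ?_ ?_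
    · rw [heig, heig]; exact hk j hj
    · rw [heig, ← htz]; exact ht.continuousAt
    · filter_upwards [hev] with x hx h0
      simp [h0] at hx
    · exact hev.mono fun x hx => hx.1
  have hF : (fun x => eigenvalueOnCochains o hH k (L x)) =ᶠ[𝓝 0]
      fun x => Complex.reCLM (t x) :=
    hkt.mono fun x hx => by simp only [hx, Complex.reCLM_apply, Complex.ofReal_re]; rfl
  -- P x is the row vector ψᵀ(A x - A 0).
  let P : V → E → ℂ := fun s x => ∑ r, (ψ r * H r s : ℂ) *
    (Complex.exp (Complex.I * (l r s x : ℂ)) - 1)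
  have hPA : ∀ x s, P s x = (ψc ᵥ* A x - ψc ᵥ* A 0) s := fun x s => by
    simp only [P, hA0, Pi.sub_apply, Matrix.vecMul, dotProduct, ← Finset.sum_sub_distrib, hAapp,
      Matrix.map_apply, ψc]
    exact Finset.sum_congr rfl fun r _ => by ring
  -- Since ψ·v = 1, pairing with ψ gives t = ψᵀA(x)v and t₀ = ψᵀA(0)v. The difference P·v is split
  -- as P·ψ + P·(v - ψ): an explicit phase sum and a remainder without second-order part.
  have htP : t =ᶠ[𝓝 0] fun x => (t₀ : ℂ) + (∑ s, ∑ r, (ψ r * H r s * ψ s : ℂ) *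
      (Complex.exp (Complex.I * (l r s x : ℂ)) - 1)) + ∑ s, P s x * (v x s - ψ s) := by
    filter_upwards [hev] with x hx
    have h1 : t x = (ψc ᵥ* A x) ⬝ᵥ v x := by
      rw [← dotProduct_mulVec, hx.1, dotProduct_smul, hx.2, smul_eq_mul, mul_one]
    have h2 : (t₀ : ℂ) = (ψc ᵥ* A 0) ⬝ᵥ v x := by
      rw [hl, smul_dotProduct, hx.2, smul_eq_mul, mul_one]
    have h3 : t x = t₀ + ∑ s, P s x * v x s := by
      simp only [hPA]
      change _ = _ + (ψc ᵥ* A x - ψc ᵥ* A 0) ⬝ᵥ v x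
      rw [sub_dotProduct, ← h1, ← h2]
      ring
    rw [h3, add_assoc, ← Finset.sum_add_distrib]
    congr 1
    refine Finset.sum_congr rfl fun s _ => ?_
    have h4 : ∑ r, (ψ r * H r s * ψ s : ℂ) * (Complex.exp (Complex.I * (l r s x : ℂ)) - 1) =
        P s x * ψ s := by
      rw [Finset.sum_mul]
      exact Finset.sum_congr rfl fun r _ => by ring
    rw [h4]
    ring
  have hPc : ∀ s, ContDiffAt ℝ 2 (P s) 0 := fun s =>
    ContDiffAt.sum fun r _ => contDiffAt_const.mul ((((contDiff_const.mul
      (Complex.ofRealCLM.contDiff.comp (l r s).contDiff)).cexp).contDiffAt).sub contDiffAt_const)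
  have hP0 : ∀ s, P s 0 = 0 := fun s => by simp [P]
  -- The harmonic gauge enters here: ψ_s times this derivative is, up to the factor -i, the boundary
  -- of ΦLu at s, and ψ_s can be cancelled.
  have hP1 : ∀ s, HasFDerivAt (P s) (0 : E →L[ℝ] ℂ) 0 := fun s => by
    have h := HasFDerivAt.fun_sum (u := Finset.univ) fun r _ =>
      (((l r s).hasFDerivAt_exp_I_mul 0).sub_const 1).const_mul (ψ r * H r s : ℂ)
    refine h.congr_fderiv ?_
    ext u
    have h1 := boundary_edgeWeight_mulVec (ψ := ψ) o hH (L u) s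
    rw [hL, Pi.zero_apply, eq_comm, neg_eq_zero] at h1
    have h2 : ψ s * ∑ r, ψ r * H r s * l r s u = 0 := by
      rw [← h1, Finset.mul_sum]
      refine Finset.sum_congr rfl fun r _ => ?_
      change _ = _ * l r s u
      ring
    have h3 := congrArg Complex.ofReal ((mul_eq_zero.1 h2).resolve_left (hne s))
    push_cast at h3
    have h4 : ∑ r, (ψ r * H r s : ℂ) * (Complex.I * (l r s u : ℂ)) = 0 := by
      rw [← mul_zero Complex.I, ← h3, Finset.mul_sum]
      exact Finset.sum_congr rfl fun r _ => by ring
    simpa using h4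
  have hvs : ∀ s, ContDiffAt ℝ 2 (fun x => v x s - (ψ s : ℂ)) 0 := fun s =>
    (contDiffAt_pi.1 hv s).sub contDiffAt_const
  choose B hB hBapp using fun r s => (l r s).hasSecondFDerivAt_exp_I_mul (ψ r * H r s * ψ s : ℂ)
  have hsecond := (((HasSecondFDerivAt.const (t₀ : ℂ)).add
    (HasSecondFDerivAt.sum (s := Finset.univ) fun s _ =>
      HasSecondFDerivAt.sum (s := Finset.univ) fun r _ => hB r s)).add
    (HasSecondFDerivAt.sum (s := Finset.univ) fun s _ =>
      HasSecondFDerivAt.mul_of_eq_zero (hPc s) (hvs s) (hP0 s) (hP1 s)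
        (by simp [hv0, ψc]))).congr_of_eventuallyEq htP
  refine ⟨(Complex.reCLM.contDiff.contDiffAt.comp 0 ht).congr_of_eventuallyEq hF, fun u w => ?_⟩
  rw [((hsecond.clm_comp Complex.reCLM).congr_of_eventuallyEq hF).iteratedFDeriv_eq]
  -- The factor 2 counts both orientations of an edge; the minus sign from i² is absorbed by the one
  -- in Φ.
  have hW := sum_mul_antisymForm_mul_antisymForm o (symm_mul_apply_mul hH ψ) (L u) (L w)
  have hΦ : L u ⬝ᵥ edgeWeight o H ψ *ᵥ L w =
      -∑ e : o.edges, ψ e.1.1 * H e.1.1 e.1.2 * ψ e.1.2 * L u e * L w e := by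
    simp only [edgeWeight, Matrix.mulVec_diagonal, dotProduct, ← Finset.sum_neg_distrib]
    exact Finset.sum_congr rfl fun e _ => by ring
  rw [hΦ, mul_neg, ← hW, Finset.sum_comm]
  have hre : ∀ r s, (-((ψ r * H r s * ψ s : ℂ) * (l r s u * l r s w))).re =
      -(ψ r * H r s * ψ s * antisymForm o (L u) r s * antisymForm o (L w) r s) := fun r s => by
    have : (-((ψ r * H r s * ψ s : ℂ) * (l r s u * l r s w))) =
      ((-(ψ r * H r s * ψ s * l r s u * l r s w) : ℝ) : ℂ) := by push_cast; ring
    rw [this, Complex.ofReal_re]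
    rfl
  simp [hBapp, hre, ← Finset.sum_neg_distrib, -Complex.neg_re, -neg_mul]

end GraphMagnetic

end

/-! ### The Hessian in flux coordinates -/

theorem corollary5p2 {V : Type*} [Fintype V] [DecidableEq V]
    (G : SimpleGraph V) (hconn : G.Connected) (o : GraphMagnetic.EdgeDirection G)
    (H : Matrix V V ℝ) (hH : H.IsHermitian) (hG : GraphMagnetic.IsStrictlySupported G H)
    (k : Fin (Fintype.card V))
    (hsimple : Module.finrank ℝ
      (Module.End.eigenspace (Matrix.toLin' H) (GraphMagnetic.ascEigenvalue hH k)) = 1)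
    (ψ : V → ℝ) (hψ : Matrix.mulVec H ψ = GraphMagnetic.ascEigenvalue hH k • ψ)
    (hnorm : ∑ r, ψ r ^ 2 = 1) (hne : ∀ r, ψ r ≠ 0)
    (β : ℕ) (C : Matrix o.edges (Fin β) ℝ) (hC : GraphMagnetic.IsFrame o C) :
    IsUnit (Matrix.transpose C * (GraphMagnetic.edgeWeight o H ψ)⁻¹ * C) ∧
    ContDiffAt ℝ 2 (fun x : Fin β → ℝ =>
      GraphMagnetic.eigenvalueOnH1 o hH hG k ((GraphMagnetic.fluxCoordinates o hC).symm x)) 0 ∧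
    GraphMagnetic.hessianMatrix (fun x : Fin β → ℝ =>
      GraphMagnetic.eigenvalueOnH1 o hH hG k ((GraphMagnetic.fluxCoordinates o hC).symm x)) 0
      = (2 : ℝ) • (Matrix.transpose C * (GraphMagnetic.edgeWeight o H ψ)⁻¹ * C)⁻¹ := by
  open GraphMagnetic in
  have hψ0 : ψ ≠ 0 := by
    rintro rfl
    simp at hnorm
  have hs : ∀ w : V → ℝ, H *ᵥ w = ascEigenvalue hH k • w → ∃ c : ℝ, w = c • ψ := fun w hw => by
    let ψ' : Module.End.eigenspace (Matrix.toLin' H) (ascEigenvalue hH k) :=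
      ⟨ψ, Module.End.mem_eigenspace_iff.2 hψ⟩
    have hψ' : ψ' ≠ 0 := fun h => hψ0 (congrArg Subtype.val h)
    obtain ⟨c, hc⟩ := (finrank_eq_one_iff_of_nonzero' ψ' hψ').1 hsimple
      ⟨w, Module.End.mem_eigenspace_iff.2 hw⟩
    exact ⟨c, (congrArg Subtype.val hc).symm⟩
  have hM := isUnit_cycleIntersection o hH hG hψ hne hs hC
  refine ⟨hM, ?_⟩
  set Φ := edgeWeight o H ψ with hΦ
  set M := Cᵀ * Φ⁻¹ * C with hMdef
  have hΦi : Φ * Φ⁻¹ = 1 := edgeWeight_mul_inv o hG hne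
  have hMi : M * M⁻¹ = 1 := Matrix.mul_nonsing_inv _ ((Matrix.isUnit_iff_isUnit_det _).1 hM)
  have hΦt : Φᵀ = Φ := Matrix.diagonal_transpose _
  have hMt : Mᵀ = M := by
    simp only [hMdef, Matrix.transpose_mul, Matrix.transpose_nonsing_inv, hΦt,
      Matrix.transpose_transpose, Matrix.mul_assoc]
  -- The harmonic representative of the flux x: ΦLx = Cz is a cycle, and CᵀLx = Mz = x forces z =
  -- M⁻¹x.
  let L := Matrix.mulVecLin (Φ⁻¹ * C * M⁻¹)
  have hflux : (fun x : Fin β → ℝ => eigenvalueOnH1 o hH hG k ((fluxCoordinates o hC).symm x)) =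
      fun x => eigenvalueOnCochains o hH k (L x) := by
    ext x
    have h : (fluxCoordinates o hC).symm x = Submodule.Quotient.mk (L x) := by
      rw [LinearEquiv.symm_apply_eq, fluxCoordinates_mk, ← Matrix.mulVec_transpose]
      change x = Cᵀ *ᵥ ((Φ⁻¹ * C * M⁻¹) *ᵥ x)
      rw [Matrix.mulVec_mulVec, ← Matrix.mul_assoc, ← Matrix.mul_assoc, ← hMdef, hMi,
        Matrix.one_mulVec]
    rw [h]
    rfl
  have hΦL : ∀ x, Φ *ᵥ L x = C *ᵥ (M⁻¹ *ᵥ x) := fun x => by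
    change Φ *ᵥ ((Φ⁻¹ * C * M⁻¹) *ᵥ x) = _
    rw [Matrix.mulVec_mulVec, ← Matrix.mul_assoc, ← Matrix.mul_assoc, hΦi, Matrix.one_mul,
      Matrix.mulVec_mulVec]
  obtain ⟨h1, h2⟩ := eigenvalueOnCochains_second_order o hH k
    (fun j hj => ascEigenvalue_ne_of_finrank_eigenspace hH hsimple hj) hψ hnorm hne hs L
    (fun x => by rw [← hΦ, hΦL, boundary_frame_mulVec o hC])
  rw [hflux]
  refine ⟨h1, ?_⟩
  ext i j
  -- Here Lx·ΦLy = Lx·CM⁻¹y = (CᵀLx)·M⁻¹y = x·M⁻¹y, taken at standard basis vectors.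
  rw [hessianMatrix, Matrix.of_apply, h2, ← hΦ, hΦL, Matrix.smul_apply, smul_eq_mul,
    dotProduct_mulVec, ← Matrix.mulVec_transpose]
  change 2 * ((Cᵀ *ᵥ ((Φ⁻¹ * C * M⁻¹) *ᵥ Pi.single i 1)) ⬝ᵥ _) = _
  rw [Matrix.mulVec_mulVec, ← Matrix.mul_assoc, ← Matrix.mul_assoc, ← hMdef, hMi,
    Matrix.one_mulVec]
  simp
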